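/- All faces below are nonempty. Let $P\subset\mathbb R^e$ be a $d$-polytope (the convex hull of finitely many points, at least one, with affine hull of dimension $d\ge 0$). A \emph{pointed triangulation} of $P$ is a finite geometric simplicial complex $\mathcal C_P$ with underlying set $P$, together with a choice of a vertex $v_F$ of $F$ (the \emph{apex} of $F$) for every face $F$ of $P$ (including $F=P$), such that, writing $\mathcal C_F=\{\sigma\in\mathcal C_P:\sigma\subseteq F\}$: (1) for every $k$ and every $k$-face $F$ of $P$, every simplex of $\mathcal C_F$ is a face of a $k$-simplex of $\mathcal C_F$, and $v_F$ lies in every $k$-simplex of $\mathcal C_F$; (2) if $F_1,F_2$ are faces of $P$ with $v_{F_1},v_{F_2}\in F_1\cap F_2$, then $v_{F_1}=v_{F_2}$; (3) for every face $F$ of $P$ and every vertex $w\neq v_F$ of $F$, the edge $\operatorname{conv}\{v_F,w\}$ belongs to $\mathcal C_F$. The \emph{polytope numbers} $P(n)$ and \emph{interior polytope numbers} $P(n)^\sharp$, $n\ge 0$, with respect to the apexes $v_F$ are defined by recursion on the dimension and on $n$, simultaneously for all faces. If $\dim P=0$, then $P(0)=P(0)^\sharp=0$ and $P(n)=P(n)^\sharp=1$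 for $n\ge1$. If $\dim P\ge 1$, then $P(0)=0$, $P(1)=1$, $P(0)^\sharp=P(1)^\sharp=0$, and for $n\ge2$ $$P(n)=P(n-1)+\sum_{F\text{ face of }P,\ v_P\notin F}F(n)^\sharp,\qquad P(n)^\sharp=P(n)-\sum_{F\text{ face of }P,\ F\ne P}F(n)^\sharp .$$ For a $k$-simplex $\alpha$, $k\ge 0$, with vertices $u_1,\dots,u_{k+1}$ let $$S_\alpha(n)=\Big\{\sum_{i=1}^{k+1}x_iu_i : x\in\mathbb N^{k+1},\ \sum_{i=1}^{k+1} x_i=n-1\Big\},\qquad \mathbb N=\{0,1,2,\dots\},$$ which is the image of $\{x\in\mathbb N^{k+1}:\sum_i x_i=n-1\}$ under the linear map $e_i\mapsto u_i$, and is empty for $n=0$. Let $\partial P$ be the set of points of $P$ that lie in a proper face of $P$. \textbf{Theorem.} Let $P$ be a $d$-polytope with a pointed triangulation $\mathcal C_P$, and let $P(n)$ and $P(n)^\sharp$ be the polytope numbers and interior polytope numbers with respect to its apexes. Then for every $n\ge0$ the sets below are finite and $$P(n)=\Big|\bigcup_{\alpha}S_{\alpha}(n)\Big|,\qquad P(n)^\sharp=\Big|\Big(\bigcup_{\alpha}S_{\alpha}(n)\Big)\setminus\Big(\bigcup_{\beta}S_{\beta}(n)\Big)\Big|,$$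 where $\alpha$ runs over the $d$-simplices of $\mathcal C_P$ and $\beta$ over the $(d-1)$-simplices of $\mathcal C_P$ contained in $\partial P$ (there are no $\beta$ when $d=0$). -/

import Mathlib

noncomputable section

namespace PolytopeNumbers

variable {E : Type*} [NormedAddCommGroup E] [NormedSpace ℝ E]

/-- The dimension of (the affine hull of) a set. -/
def dim (P : Set E) : ℕ := Module.finrank ℝ (vectorSpan ℝ P)

/-- `P` is a `d`-polytope: the convex hull of a finite nonempty set of points, of dimension `d`. -/
def IsPolytope (d : ℕ) (P : Set E) : Prop :=
  (∃ t : Finset E, t.Nonempty ∧ P = convexHull ℝ (t : Set E)) ∧ dim P = d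

/-- `F` is a nonempty face of `P` (the set where some linear functional is maximal on `P`;
`F = P` is allowed). The empty face has no apex and is never used. -/
def IsFace (P F : Set E) : Prop := F.Nonempty ∧ IsExposed ℝ P F

/-- `F` is a nonempty proper face of `P`. -/
def IsProperFace (P F : Set E) : Prop := IsFace P F ∧ F ≠ P

/-- The vertices of `P`: the points `x` such that `{x}` is a face. -/
def vert (P : Set E) : Set E := {x | IsFace P {x}}

/-- The boundary of `P`: the points of `P` that lie in some proper face. -/
def boundary (P : Set E) : Set E := {x | x ∈ P ∧ ∃ F, IsProperFace P F ∧ x ∈ F}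

theorem IsProperFace.dim_lt [FiniteDimensional ℝ E] {P F : Set E} (h : IsProperFace P F) :
    dim F < dim P := by
  obtain ⟨⟨hne, hexp⟩, hFP⟩ := h
  have hsub : F ⊆ P := hexp.subset
  obtain ⟨l, hl⟩ := hexp hne
  obtain ⟨x, hx⟩ := hne
  obtain ⟨y, hyP, hyF⟩ : ∃ y ∈ P, y ∉ F := by
    by_contra! hc
    exact hFP (hsub.antisymm hc)
  have hker : vectorSpan ℝ F ≤ LinearMap.ker (l : E →ₗ[ℝ] ℝ) := by
    rw [vectorSpan, Submodule.span_le]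
    rintro _ ⟨a, ha, b, hb, rfl⟩
    rw [hl] at ha hb
    have := le_antisymm (ha.2 b hb.1) (hb.2 a ha.1)
    simp [this]
  apply Submodule.finrank_lt_finrank_of_lt
  refine lt_of_le_of_ne (vectorSpan_mono ℝ hsub) fun heq => ?_
  have hyx : y - x ∈ vectorSpan ℝ F := by
    rw [heq]
    exact vsub_mem_vectorSpan ℝ hyP (hsub hx)
  have h0 : l y = l x := by
    have := hker hyx
    simpa [sub_eq_zero] using this
  apply hyF
  rw [hl] at hx ⊢
  exact ⟨hyP, fun z hz => h0 ▸ hx.2 z hz⟩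

/- The polytope numbers `P(n)` and the interior polytope numbers `P(n)^♯` with respect to a choice
`v` of a vertex `v F` of every face `F`, by double recursion on the dimension and on `n`.
In the sum for `P(n)` the requirement `F ≠ P` is implied by `v P ∉ F` whenever `v P ∈ P`. -/
mutual

/-- The `v`-polytope numbers `P(n)`. -/
def polytopeNumber [FiniteDimensional ℝ E] (v : Set E → E) (P : Set E) (n : ℕ) : ℤ :=
  match n with
  | 0 => 0
  | 1 => 1
  | n + 2 =>
    if dim P = 0 then 1
    else polytopeNumber v P (n + 1) +
      ∑ᶠ F : {F : Set E // IsProperFace P F ∧ v P ∉ F},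
        interiorPolytopeNumber v F.1 (n + 2)
termination_by (dim P, n, 0)
decreasing_by
  · decreasing_tactic
  · exact Prod.Lex.left _ _ F.2.1.dim_lt

/-- The interior `v`-polytope numbers `P(n)^♯`. -/
def interiorPolytopeNumber [FiniteDimensional ℝ E] (v : Set E → E) (P : Set E) (n : ℕ) : ℤ :=
  match n with
  | 0 => 0
  | 1 => if dim P = 0 then 1 else 0
  | n + 2 =>
    if dim P = 0 then 1
    else polytopeNumber v P (n + 2) -
      ∑ᶠ F : {F : Set E // IsProperFace P F}, interiorPolytopeNumber v F.1 (n + 2)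
termination_by (dim P, n, 1)
decreasing_by
  · decreasing_tactic
  · exact Prod.Lex.left _ _ F.2.dim_lt

end

/-- The set of `k`-simplices of `K` that are contained in `A`, each given by its vertex set. For a
face `F` of a polytope triangulated by `K`, the simplices of `K` contained in `F` form the induced
triangulation of `F`. -/
def simplicesIn (K : Geometry.SimplicialComplex ℝ E) (A : Set E) (k : ℕ) : Set (Finset E) :=
  {s | s ∈ K.faces ∧ convexHull ℝ (s : Set E) ⊆ A ∧ s.card = k + 1}

/-- `K` is a pointed triangulation of `P` with apexes `v F`, `F` a face of `P`. -/
structure IsPointedTriangulation (P : Set E) (K : Geometry.SimplicialComplex ℝ E)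
    (v : Set E → E) : Prop where
  finite_faces : K.faces.Finite
  space_eq : K.space = P
  /-- The triangulation of a `k`-face `F` induced by `K` is generated by its `k`-simplices. -/
  pure_face : ∀ F, IsFace P F → ∀ s ∈ K.faces, convexHull ℝ (s : Set E) ⊆ F →
    ∃ t ∈ simplicesIn K F (dim F), s ⊆ t
  apex_vert : ∀ F, IsFace P F → v F ∈ vert F
  /-- The apex of a `k`-face lies in all `k`-simplices of the triangulation of this face. -/
  apex_mem : ∀ F, IsFace P F → ∀ s ∈ simplicesIn K F (dim F), v F ∈ convexHull ℝ (s : Set E)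
  apex_eq : ∀ F₁ F₂, IsFace P F₁ → IsFace P F₂ → {v F₁, v F₂} ⊆ F₁ ∩ F₂ → v F₁ = v F₂
  /-- The apex of a face is joined by an edge of the triangulation to all its other vertices. -/
  edge_mem : ∀ F, IsFace P F → ∀ w ∈ vert F, w ≠ v F →
    ∃ s ∈ K.faces, (s : Set E) = {v F, w}

/-- The points of the standard simplex: `{x ∈ ℕ^ι | ∑ x = n - 1}`, empty for `n = 0`. -/
def standardPoints (ι : Type*) [Fintype ι] (n : ℕ) : Set (ι → ℕ) :=
  {x | ((∑ i, x i : ℕ) : ℤ) = (n : ℤ) - 1}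

/-- The point set `S_α(n)` of the simplex `α` with vertex set `s`: the image of the points of the
standard simplex under the map that sends the unit vector at `u ∈ s` to the vertex `u`. -/
def pointSet (s : Finset E) (n : ℕ) : Set E :=
  (fun x : s → ℕ => ∑ u, (x u : ℝ) • (u : E)) '' standardPoints s n

/-- `S_P(n)`: the union of the point sets of the `d`-simplices of the triangulation. -/
def unionPoints (d : ℕ) (K : Geometry.SimplicialComplex ℝ E) (n : ℕ) : Set E :=
  ⋃ s ∈ {s | s ∈ K.faces ∧ s.card = d + 1}, pointSet s n

/-- The union of the point sets of the `(d-1)`-simplices of the triangulation in the boundary of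
`P`. A `(d-1)`-simplex has `d` vertices; faces of `K` are nonempty, so there is none for `d = 0`. -/
def boundaryPoints (d : ℕ) (P : Set E) (K : Geometry.SimplicialComplex ℝ E) (n : ℕ) : Set E :=
  ⋃ s ∈ {s | s ∈ K.faces ∧ s.card = d ∧ convexHull ℝ (s : Set E) ⊆ boundary P}, pointSet s n

end PolytopeNumbers

end

/-!
A point of `S_α(m + 1)` is the sum of a multiset of `m` vertices of `α`, and two multisets supported
on simplices of a geometric simplicial complex with the same size and the same sum are equal,
because the sum determines barycentric coordinates. So one counts multisets instead of points. Every
multiset has a carrier, the smallest face of `P` containing it, and sorting multisets by their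
carriers gives the recursion for the interior polytope numbers. For the recursion for `P(n)`, a
multiset either contains the apex, and then one copy of it can be removed, or has a carrier that
avoids the apex. The latter holds because the apex of `F` belongs to every simplex `s` with carrier
`F`: a segment from the apex to a relatively interior point of `s` can be prolonged inside `F`, and
the top-dimensional simplex of `F` in which it ends contains the apex. Finally, the multisets lying
in a proper face are those on the boundary `(d-1)`-simplices, because every proper face is contained
in a facet.
-/

namespace PolytopeNumbers

/-- `w` is a system of barycentric coordinates of the point `x` with respect to the vertex set `s`.
Coordinates are extended by zero outside `s`, so that coordinates with respect to different
simplices can be compared. -/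
structure IsBarycentric {𝕜 V : Type*} [Semiring 𝕜] [PartialOrder 𝕜] [AddCommMonoid V] [Module 𝕜 V]
    (s : Finset V) (x : V) (w : V → 𝕜) : Prop where
  nonneg : ∀ u, 0 ≤ w u
  eq_zero_of_notMem : ∀ u ∉ s, w u = 0
  sum_eq_one : ∑ u ∈ s, w u = 1
  sum_smul_eq : ∑ u ∈ s, w u • u = x

namespace IsBarycentric

section Semiring

variable {𝕜 V : Type*} [Semiring 𝕜] [PartialOrder 𝕜] [AddCommMonoid V] [Module 𝕜 V]
  {s t : Finset V} {x y : V} {w z : V → 𝕜}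

theorem mem_of_ne_zero (hw : IsBarycentric s x w) {u : V} (hu : w u ≠ 0) : u ∈ s :=
  not_imp_comm.1 (hw.eq_zero_of_notMem u) hu

theorem mono (hw : IsBarycentric s x w) (hst : s ⊆ t) : IsBarycentric t x w where
  nonneg := hw.nonneg
  eq_zero_of_notMem u hu := hw.eq_zero_of_notMem u fun hus => hu (hst hus)
  sum_eq_one := by
    rw [← hw.sum_eq_one, Finset.sum_subset hst fun u _ hu => hw.eq_zero_of_notMem u hu]
  sum_smul_eq := by
    rw [← hw.sum_smul_eq, Finset.sum_subset hst fun u _ hu => by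
      rw [hw.eq_zero_of_notMem u hu, zero_smul]]

variable [IsOrderedRing 𝕜]

theorem combo (hw : IsBarycentric s x w) (hz : IsBarycentric s y z) {a b : 𝕜} (ha : 0 ≤ a)
    (hb : 0 ≤ b) (hab : a + b = 1) : IsBarycentric s (a • x + b • y) (a • w + b • z) where
  nonneg u := add_nonneg (mul_nonneg ha (hw.nonneg u)) (mul_nonneg hb (hz.nonneg u))
  eq_zero_of_notMem u hu := by simp [hw.eq_zero_of_notMem u hu, hz.eq_zero_of_notMem u hu]
  sum_eq_one := by
    simp [Finset.sum_add_distrib, ← Finset.mul_sum, hw.sum_eq_one, hz.sum_eq_one, hab]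
  sum_smul_eq := by
    simp [add_smul, mul_smul, Finset.sum_add_distrib, ← Finset.smul_sum, hw.sum_smul_eq,
      hz.sum_smul_eq]

theorem single [DecidableEq V] {u : V} (hu : u ∈ s) :
    IsBarycentric s u (Pi.single u 1 : V → 𝕜) where
  nonneg := (Pi.single_nonneg (i := u)).2 zero_le_one
  eq_zero_of_notMem _ hy := Pi.single_eq_of_ne (ne_of_mem_of_not_mem hu hy).symm 1
  sum_eq_one := by simp [hu]
  sum_smul_eq := by simp [Pi.single_apply, ite_smul, hu]

end Semiring

theorem unique {𝕜 V : Type*} [Ring 𝕜] [PartialOrder 𝕜] [AddCommGroup V] [Module 𝕜 V]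
    {s : Finset V} {x : V} {w z : V → 𝕜} (hs : AffineIndependent 𝕜 ((↑) : s → V))
    (hw : IsBarycentric s x w) (hz : IsBarycentric s x z) : w = z := by
  funext u
  by_cases hu : u ∈ s
  · refine sub_eq_zero.1 (hs.eq_zero_of_sum_eq_zero_subtype (w := w - z) ?_ ?_ u hu)
    · simp [hw.sum_eq_one, hz.sum_eq_one]
    · simp [sub_smul, hw.sum_smul_eq, hz.sum_smul_eq]
  · rw [hw.eq_zero_of_notMem u hu, hz.eq_zero_of_notMem u hu]

end IsBarycentric

section Field

variable {𝕜 V : Type*} [Field 𝕜] [LinearOrder 𝕜] [IsStrictOrderedRing 𝕜] [AddCommGroup V]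
  [Module 𝕜 V] {s t : Finset V} {x : V} {w z : V → 𝕜}

theorem mem_convexHull_iff_exists_isBarycentric :
    x ∈ convexHull 𝕜 (s : Set V) ↔ ∃ w : V → 𝕜, IsBarycentric s x w := by
  classical
  rw [Finset.mem_convexHull']
  refine ⟨fun ⟨w, hw₀, hw₁, hwx⟩ => ⟨fun u => if u ∈ s then w u else 0, ?_, ?_, ?_, ?_⟩,
    fun ⟨w, hw⟩ => ⟨w, fun u _ => hw.nonneg u, hw.sum_eq_one, hw.sum_smul_eq⟩⟩
  · intro u
    split_ifs with hu
    exacts [hw₀ u hu, le_rfl]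
  · exact fun u hu => if_neg hu
  · rw [← hw₁]
    exact Finset.sum_congr rfl fun u hu => if_pos hu
  · rw [← hwx]
    exact Finset.sum_congr rfl fun u hu => by rw [if_pos hu]

theorem IsBarycentric.mem_convexHull (hw : IsBarycentric s x w) : x ∈ convexHull 𝕜 (s : Set V) :=
  mem_convexHull_iff_exists_isBarycentric.2 ⟨w, hw⟩

theorem isBarycentric_count [DecidableEq V] {m : Multiset V} (hm : m ≠ 0) (hms : ∀ u ∈ m, u ∈ s) :
    IsBarycentric s ((m.card : 𝕜)⁻¹ • m.sum) fun u => (m.card : 𝕜)⁻¹ * m.count u where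
  nonneg u := by positivity
  eq_zero_of_notMem u hu := by simp [Multiset.count_eq_zero_of_notMem fun h => hu (hms u h)]
  sum_eq_one := by
    rw [← Finset.mul_sum, ← Nat.cast_sum, Multiset.sum_count_eq_card hms,
      inv_mul_cancel₀ (by simpa using hm)]
  sum_smul_eq := by
    simp only [mul_smul, ← Finset.smul_sum, Nat.cast_smul_eq_nsmul]
    rw [← Finset.sum_multiset_count_of_subset m s fun u hu => hms u (Multiset.mem_toFinset.1 hu)]

theorem exists_isBarycentric_ne_zero (hs : s.Nonempty) :
    ∃ x, ∃ w : V → 𝕜, IsBarycentric s x w ∧ ∀ u ∈ s, w u ≠ 0 := by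
  classical
  have hs' : s.val ≠ 0 := by simpa using hs.ne_empty
  refine ⟨_, _, isBarycentric_count hs' fun u hu => hu, fun u hu => mul_ne_zero ?_ ?_⟩
  · simpa using hs.ne_empty
  · simpa [Multiset.count_eq_zero] using hu

theorem IsBarycentric.unique_of_mem_faces {K : Geometry.SimplicialComplex 𝕜 V} (hs : s ∈ K.faces)
    (ht : t ∈ K.faces) (hw : IsBarycentric s x w) (hz : IsBarycentric t x z) : w = z := by
  classical
  have hx : x ∈ convexHull 𝕜 (s ∩ t : Set V) :=
    K.inter_subset_convexHull hs ht ⟨hw.mem_convexHull, hz.mem_convexHull⟩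
  rw [← Finset.coe_inter] at hx
  obtain ⟨y, hy⟩ := mem_convexHull_iff_exists_isBarycentric.1 hx
  exact (hw.unique (K.indep hs) (hy.mono Finset.inter_subset_left)).trans
    (hz.unique (K.indep ht) (hy.mono Finset.inter_subset_right)).symm

end Field

section LinearAlgebra

theorem vectorSpan_le_ker_of_forall_eq {𝕜 V W : Type*} [Ring 𝕜] [AddCommGroup V] [Module 𝕜 V]
    [AddCommGroup W] [Module 𝕜 W] {A : Set V} {f : V →ₗ[𝕜] W} {c : W} (h : ∀ x ∈ A, f x = c) :
    vectorSpan 𝕜 A ≤ LinearMap.ker f := by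
  refine Submodule.span_le.2 ?_
  rintro _ ⟨x, hx, y, hy, rfl⟩
  simp [h x hx, h y hy]

theorem exists_mem_ker_notMem_of_finrank_lt {𝕜 V : Type*} [Field 𝕜] [AddCommGroup V] [Module 𝕜 V]
    [FiniteDimensional 𝕜 V] {S T : Submodule 𝕜 V}
    (hST : Module.finrank 𝕜 T + 1 < Module.finrank 𝕜 S) (f : Module.Dual 𝕜 V) :
    ∃ u ∈ S, f u = 0 ∧ u ∉ T := by
  by_contra! hT
  have hinf : S ⊓ LinearMap.ker f ≤ T := fun u hu => hT u hu.1 hu.2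
  have := Submodule.finrank_mono hinf
  have := Submodule.finrank_sup_add_finrank_inf_eq S (LinearMap.ker f)
  have := Submodule.finrank_le (S ⊔ LinearMap.ker f)
  have := f.finrank_range_add_finrank_ker
  have : Module.finrank 𝕜 (LinearMap.range f) ≤ 1 :=
    (Submodule.finrank_le _).trans (Module.finrank_self 𝕜).le
  omega

theorem affineSpan_preimage_add_vectorSpan_eq_top {𝕜 V : Type*} [Ring 𝕜] [AddCommGroup V]
    [Module 𝕜 V] {A : Set V} {x : V} (hx : x ∈ A) :
    affineSpan 𝕜 ((fun u : vectorSpan 𝕜 A => x + (u : V)) ⁻¹' A) = ⊤ := by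
  set f : vectorSpan 𝕜 A →ᵃ[𝕜] V := AffineMap.const 𝕜 _ x + (vectorSpan 𝕜 A).subtype.toAffineMap
  have himage : f '' (f ⁻¹' A) = A := Set.image_preimage_eq_of_subset fun y hy =>
    ⟨⟨y - x, vsub_mem_vectorSpan 𝕜 hy hx⟩, add_sub_cancel x y⟩
  have hspan : vectorSpan 𝕜 (f ⁻¹' A) = ⊤ := by
    refine Submodule.map_injective_of_injective (vectorSpan 𝕜 A).injective_subtype ?_
    have hlin : f.linear = (vectorSpan 𝕜 A).subtype := by simp [f]
    rw [Submodule.map_subtype_top, ← hlin, AffineMap.map_vectorSpan, himage]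
  have hzero : (0 : vectorSpan 𝕜 A) ∈ f ⁻¹' A := by simpa [f] using hx
  exact (AffineSubspace.affineSpan_eq_top_iff_vectorSpan_eq_top_of_nonempty 𝕜 _ _ ⟨0, hzero⟩).2
    hspan

end LinearAlgebra

section ConvexHull

theorem le_of_mem_convexHull {𝕜 V : Type*} [Semiring 𝕜] [PartialOrder 𝕜] [IsOrderedRing 𝕜]
    [AddCommMonoid V] [Module 𝕜 V] {A : Set V} {f : V →ₗ[𝕜] 𝕜} {c : 𝕜}
    (h : ∀ x ∈ A, f x ≤ c) {x : V} (hx : x ∈ convexHull 𝕜 A) : f x ≤ c :=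
  convexHull_min (t := {x | f x ≤ c}) h (convex_halfSpace_le f.isLinear c) hx

theorem convexHull_inter_subset_of_isExtreme {𝕜 V : Type*} [Ring 𝕜] [PartialOrder 𝕜]
    [IsOrderedRing 𝕜] [AddCommGroup V] [Module 𝕜 V] {A P F : Set V} (hF : IsExtreme 𝕜 P F)
    (hA : convexHull 𝕜 A ⊆ P) : convexHull 𝕜 A ∩ F ⊆ convexHull 𝕜 (A ∩ F) := by
  suffices h : convexHull 𝕜 A ⊆ {x ∈ convexHull 𝕜 A | x ∈ F → x ∈ convexHull 𝕜 (A ∩ F)} from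
    fun x hx => (h hx.1).2 hx.2
  refine convexHull_min (fun x hx => ⟨subset_convexHull 𝕜 A hx, fun hxF =>
    subset_convexHull 𝕜 _ ⟨hx, hxF⟩⟩) (convex_iff_openSegment_subset.2 ?_)
  intro x hx y hy z hz
  refine ⟨(convex_convexHull 𝕜 A).openSegment_subset hx.1 hy.1 hz, fun hzF => ?_⟩
  exact (convex_convexHull 𝕜 (A ∩ F)).openSegment_subset
    (hx.2 (hF.left_mem_of_mem_openSegment (hA hx.1) (hA hy.1) hzF hz))
    (hy.2 (hF.right_mem_of_mem_openSegment (hA hx.1) (hA hy.1) hzF hz)) hz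

end ConvexHull

variable {E : Type*} [NormedAddCommGroup E] [NormedSpace ℝ E] {P F G : Set E} {d : ℕ}

section Faces

theorem IsPolytope.nonempty (hP : IsPolytope d P) : P.Nonempty := by
  obtain ⟨⟨t, ht, rfl⟩, -⟩ := hP
  exact convexHull_nonempty_iff.2 ht

theorem IsPolytope.convex (hP : IsPolytope d P) : Convex ℝ P := by
  obtain ⟨⟨t, -, rfl⟩, -⟩ := hP
  exact convex_convexHull ℝ _

theorem IsFace.refl (hP : P.Nonempty) : IsFace P P := ⟨hP, .refl P⟩

theorem IsFace.subset (hF : IsFace P F) : F ⊆ P := hF.2.subset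

theorem IsFace.convex (hF : IsFace P F) (hP : Convex ℝ P) : Convex ℝ F := hF.2.convex hP

theorem IsFace.isExtreme (hF : IsFace P F) : IsExtreme ℝ P F := hF.2.isExtreme

theorem IsFace.mono (hG : IsFace P G) (hFP : F ⊆ P) (hGF : G ⊆ F) : IsFace F G :=
  ⟨hG.1, hG.2.mono hFP hGF⟩

theorem IsFace.inter (hF : IsFace P F) (hG : IsFace P G) (hFG : (F ∩ G).Nonempty) :
    IsFace P (F ∩ G) :=
  ⟨hFG, hF.2.inter hG.2⟩

theorem isFace_iff_exists_dual :
    IsFace P F ↔ F.Nonempty ∧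
      ∃ (φ : StrongDual ℝ E) (M : ℝ), (∀ x ∈ P, φ x ≤ M) ∧ F = {x ∈ P | φ x = M} := by
  refine and_congr_right fun ⟨p, hp⟩ => ⟨fun hF => ?_, ?_⟩
  · obtain ⟨φ, rfl⟩ := hF ⟨p, hp⟩
    exact ⟨φ, φ p, hp.2, Set.ext fun x => and_congr_right fun hx =>
      ⟨fun h => le_antisymm (hp.2 x hx) (h p hp.1), fun h y hy => h ▸ hp.2 y hy⟩⟩
  · rintro ⟨φ, M, hφ, rfl⟩ -
    exact ⟨φ, Set.ext fun x => and_congr_right fun hx =>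
      ⟨fun h y hy => h ▸ hφ y hy, fun h => le_antisymm (hφ x hx) (hp.2 ▸ h p hp.1)⟩⟩

theorem IsFace.mem_of_isBarycentric (hF : IsFace P F) {s : Finset E} (hs : (s : Set E) ⊆ P) {x : E}
    {w : E → ℝ} (hw : IsBarycentric s x w) (hx : x ∈ F) {u : E} (hu : w u ≠ 0) : u ∈ F := by
  obtain ⟨-, φ, M, hφ, rfl⟩ := isFace_iff_exists_dual.1 hF
  have hgap : ∀ y ∈ s, 0 ≤ w y * (M - φ y) := fun y hy =>
    mul_nonneg (hw.nonneg y) (sub_nonneg.2 (hφ y (hs hy)))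
  have hsum : ∑ y ∈ s, w y * (M - φ y) = 0 := by
    have hφx : ∑ y ∈ s, w y * φ y = M := by
      rw [← hx.2, ← hw.sum_smul_eq]
      simp
    simp only [mul_sub, Finset.sum_sub_distrib, ← Finset.sum_mul, hw.sum_eq_one, one_mul, hφx,
      sub_self]
  have hus : u ∈ s := hw.mem_of_ne_zero hu
  have hMu : M - φ u = 0 :=
    (mul_eq_zero.1 ((Finset.sum_eq_zero_iff_of_nonneg hgap).1 hsum u hus)).resolve_left hu
  exact ⟨hs hus, (sub_eq_zero.1 hMu).symm⟩

theorem IsPolytope.finite_setOf_isFace (hP : IsPolytope d P) : {F | IsFace P F}.Finite := by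
  obtain ⟨⟨t, -, rfl⟩, -⟩ := hP
  refine (t.finite_toSet.finite_subsets.image (convexHull ℝ)).subset fun F hF => ?_
  refine ⟨t ∩ F, Set.inter_subset_left, ?_⟩
  refine (convexHull_min Set.inter_subset_right (hF.convex (convex_convexHull ℝ _))).antisymm ?_
  exact fun x hx => convexHull_inter_subset_of_isExtreme hF.isExtreme subset_rfl ⟨hF.subset hx, hx⟩

theorem IsPolytope.exists_sub_le_mul_sub (hP : IsPolytope d P) {φ ψ : StrongDual ℝ E} {M M' : ℝ}
    (hφ : ∀ x ∈ P, φ x ≤ M) (hψ : ∀ x ∈ P, φ x = M → ψ x ≤ M') :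
    ∃ N : ℝ, ∀ x ∈ P, ψ x - M' ≤ N * (M - φ x) := by
  classical
  obtain ⟨⟨t, -, rfl⟩, -⟩ := hP
  obtain ⟨N, hN⟩ := (t.image fun w => (ψ w - M') / (M - φ w)).exists_le
  refine ⟨N, fun x hx => ?_⟩
  suffices h : (N • φ + ψ : E →ₗ[ℝ] ℝ) x ≤ N * M + M' by
    simp only [LinearMap.add_apply, LinearMap.smul_apply, smul_eq_mul,
      ContinuousLinearMap.coe_coe] at h
    linarith
  refine le_of_mem_convexHull (fun w hw => ?_) hx
  have hwP := subset_convexHull ℝ _ hw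
  simp only [LinearMap.add_apply, LinearMap.smul_apply, smul_eq_mul, ContinuousLinearMap.coe_coe]
  rcases (hφ w hwP).eq_or_lt with hwM | hwM
  · linarith [hψ w hwP hwM, congrArg (N * ·) hwM]
  · have hle := hN _ (Finset.mem_image_of_mem _ hw)
    rw [div_le_iff₀ (sub_pos.2 hwM)] at hle
    linarith

theorem IsFace.trans (hP : IsPolytope d P) (hF : IsFace P F) (hG : IsFace F G) : IsFace P G := by
  obtain ⟨-, φ, M, hφ, rfl⟩ := isFace_iff_exists_dual.1 hF
  obtain ⟨hne, ψ, M', hψ, rfl⟩ := isFace_iff_exists_dual.1 hG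
  obtain ⟨N, hN⟩ := hP.exists_sub_le_mul_sub hφ fun x hx hxM => hψ x ⟨hx, hxM⟩
  refine isFace_iff_exists_dual.2 ⟨hne, (N + 1) • φ + ψ, (N + 1) * M + M', fun x hx => ?_, ?_⟩
  · simp only [add_apply, smul_apply, smul_eq_mul]
    linarith [hN x hx, hφ x hx]
  · ext x
    simp only [Set.mem_ofPred_eq, add_apply, smul_apply, smul_eq_mul, and_assoc]
    refine and_congr_right fun hx => ⟨fun ⟨h, h'⟩ => by rw [h, h'], fun h => ?_⟩
    have hxM : φ x = M := by linarith [hN x hx, hφ x hx]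
    exact ⟨hxM, by rw [hxM] at h; linarith⟩

/-- `F` is the carrier of `A`: the smallest face containing `A`, described through the proper faces
of `F` only. -/
def IsCarrier (F A : Set E) : Prop := A ⊆ F ∧ ∀ G, IsProperFace F G → ¬A ⊆ G

theorem IsPolytope.exists_isCarrier (hP : IsPolytope d P) (hF : IsFace P F) {A : Set E}
    (hA : A ⊆ F) : ∃ G, IsFace P G ∧ G ⊆ F ∧ IsCarrier G A := by
  have hfin : {G | IsFace P G ∧ A ⊆ G}.Finite := hP.finite_setOf_isFace.subset fun G hG => hG.1
  obtain ⟨G, hGF, hG⟩ := hfin.exists_le_minimal ⟨hF, hA⟩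
  refine ⟨G, hG.prop.1, hGF, hG.prop.2, fun H hH hAH => hH.2 ?_⟩
  exact hG.eq_of_subset ⟨hG.prop.1.trans hP hH.1, hAH⟩ hH.1.subset

theorem IsCarrier.subset {A : Set E} (hA : A.Nonempty) (hF : IsFace P F) (hG : IsFace P G)
    (hFA : IsCarrier F A) (hAG : A ⊆ G) : F ⊆ G := by
  by_contra hFG
  have hAFG : A ⊆ F ∩ G := Set.subset_inter hFA.1 hAG
  have hface : IsFace F (F ∩ G) :=
    (hF.inter hG (hA.mono hAFG)).mono hF.subset Set.inter_subset_left
  exact hFA.2 _ ⟨hface, fun h => hFG (Set.inter_eq_left.1 h)⟩ hAFG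

theorem IsCarrier.eq {A : Set E} (hA : A.Nonempty) (hF : IsFace P F) (hG : IsFace P G)
    (hFA : IsCarrier F A) (hGA : IsCarrier G A) : F = G :=
  (hFA.subset hA hF hG hGA.1).antisymm (hGA.subset hA hG hF hFA.1)

theorem convexHull_subset_boundary_iff (hP : Convex ℝ P) {s : Finset E} (hs : s.Nonempty)
    (hsP : (s : Set E) ⊆ P) :
    convexHull ℝ (s : Set E) ⊆ boundary P ↔ ∃ G, IsProperFace P G ∧ (s : Set E) ⊆ G := by
  refine ⟨fun h => ?_, fun ⟨G, hG, hsG⟩ x hx => ?_⟩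
  · obtain ⟨x, w, hw, hpos⟩ := exists_isBarycentric_ne_zero (𝕜 := ℝ) hs
    obtain ⟨-, G, hG, hxG⟩ := h hw.mem_convexHull
    exact ⟨G, hG, fun u hu => hG.1.mem_of_isBarycentric hsP hw hxG (hpos u hu)⟩
  · have hxG := convexHull_min hsG (hG.1.convex hP) hx
    exact ⟨hG.1.subset hxG, G, hG, hxG⟩

end Faces

theorem IsPolytope.exists_tilt (hP : IsPolytope d P) {φ g : E →ₗ[ℝ] ℝ} {M c : ℝ}
    (hφ : ∀ x ∈ P, φ x ≤ M) (hg : ∀ x ∈ P, φ x = M → g x ≤ c) (hgc : ∃ x ∈ P, c < g x) :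
    ∃ τ > 0, (∀ x ∈ P, (φ + τ • g) x ≤ M + τ * c) ∧
      ∃ w ∈ P, c < g w ∧ (φ + τ • g) w = M + τ * c := by
  obtain ⟨⟨t, -, rfl⟩, -⟩ := hP
  have htP : (t : Set E) ⊆ convexHull ℝ t := subset_convexHull ℝ _
  have hne : (t.filter fun w => c < g w).Nonempty := by
    by_contra! hempty
    obtain ⟨x, hx, hcx⟩ := hgc
    refine hcx.not_ge (le_of_mem_convexHull (fun w hw => not_lt.1 fun hcw => ?_) hx)
    exact Finset.notMem_empty w (hempty ▸ Finset.mem_filter.2 ⟨hw, hcw⟩)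
  -- the ratio test of the simplex algorithm: `τ` is the smallest slope `(M - φ w) / (g w - c)`
  obtain ⟨w, hw, hmin⟩ := Finset.exists_min_image _ (fun w => (M - φ w) / (g w - c)) hne
  obtain ⟨hwt, hcw⟩ := Finset.mem_filter.1 hw
  have hφw : φ w < M := (hφ w (htP hwt)).lt_of_ne fun h => hcw.not_ge (hg w (htP hwt) h)
  have hτ : 0 < (M - φ w) / (g w - c) := div_pos (sub_pos.2 hφw) (sub_pos.2 hcw)
  refine ⟨_, hτ, fun x hx => le_of_mem_convexHull (fun y hy => ?_) hx, w, htP hwt, hcw, ?_⟩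
  · simp only [LinearMap.add_apply, LinearMap.smul_apply, smul_eq_mul]
    rcases le_or_gt (g y) c with hyc | hyc
    · linarith [hφ y (htP hy), mul_le_mul_of_nonneg_left hyc hτ.le]
    · have hslope := hmin y (Finset.mem_filter.2 ⟨hy, hyc⟩)
      rw [le_div_iff₀ (sub_pos.2 hyc)] at hslope
      linarith
  · have hslope := div_mul_cancel₀ (M - φ w) (sub_pos.2 hcw).ne'
    simp only [LinearMap.add_apply, LinearMap.smul_apply, smul_eq_mul]
    linarith

section FiniteDimensional

variable [FiniteDimensional ℝ E]

theorem IsPolytope.exists_ssuperset_of_dim_lt (hP : IsPolytope d P) (hF : IsProperFace P F)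
    (hdim : dim F + 1 < dim P) : ∃ G, IsProperFace P G ∧ F ⊂ G := by
  obtain ⟨⟨p, hp⟩, φ, M, hφ, hFeq⟩ := isFace_iff_exists_dual.1 hF.1
  obtain ⟨u, huP, huφ, huF⟩ := exists_mem_ker_notMem_of_finrank_lt hdim φ.toLinearMap
  obtain ⟨g, hgu, hgF, hgP⟩ : ∃ g : E →ₗ[ℝ] ℝ, g u ≠ 0 ∧ vectorSpan ℝ F ≤ LinearMap.ker g ∧
      ∃ x ∈ P, g p < g x := by
    obtain ⟨g, hgu, hgF⟩ := Submodule.exists_le_ker_of_notMem huF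
    obtain ⟨x, hx, hgx⟩ : ∃ x ∈ P, g x ≠ g p := by
      by_contra! hconst
      exact hgu (vectorSpan_le_ker_of_forall_eq hconst huP)
    rcases hgx.lt_or_gt with hlt | hlt
    · exact ⟨-g, by simpa using hgu, fun y hy => by simpa using hgF hy, x, hx, by simpa using hlt⟩
    · exact ⟨g, hgu, hgF, x, hx, hlt⟩
  have hgconst : ∀ x ∈ F, g x = g p := fun x hx => by
    simpa [sub_eq_zero] using hgF (vsub_mem_vectorSpan ℝ hx hp)
  obtain ⟨τ, hτ, hle, w, hwP, hgw, hw⟩ := hP.exists_tilt (φ := φ.toLinearMap) hφ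
    (fun x hx hxM => (hgconst x (hFeq ▸ ⟨hx, hxM⟩)).le) hgP
  refine ⟨{x ∈ P | (φ + τ • g.toContinuousLinearMap) x = M + τ * g p},
    ⟨isFace_iff_exists_dual.2 ⟨⟨w, hwP, hw⟩, _, _, hle, rfl⟩, fun hGP => ?_⟩, ?_, fun hGF => ?_⟩
  · have hker := vectorSpan_le_ker_of_forall_eq (f := φ.toLinearMap + τ • g)
      (fun x hx => (hGP.ge hx).2) huP
    exact mul_ne_zero hτ.ne' hgu (by simpa [huφ] using hker)
  · intro x hx
    have hxM : φ x = M := (hFeq.le hx).2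
    exact ⟨hF.1.subset hx, by simp [hxM, hgconst x hx]⟩
  · exact hgw.ne' (hgconst w (hGF ⟨hwP, hw⟩))

theorem IsPolytope.exists_facet (hP : IsPolytope d P) (hF : IsProperFace P F) :
    ∃ G, IsProperFace P G ∧ F ⊆ G ∧ dim G + 1 = dim P := by
  have hfin : {G | IsProperFace P G}.Finite := hP.finite_setOf_isFace.subset fun G hG => hG.1
  obtain ⟨G, hFG, hG⟩ := hfin.exists_le_maximal hF
  refine ⟨G, hG.prop, hFG, ?_⟩
  by_contra hdim
  obtain ⟨H, hH, hGH⟩ := hP.exists_ssuperset_of_dim_lt hG.prop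
    (lt_of_le_of_ne hG.prop.dim_lt hdim)
  exact hGH.not_subset (hG.le_of_ge hH hGH.subset)

theorem zero_mem_interior_preimage_add (hP : Convex ℝ P) {x : E} (hx : x ∈ P)
    (hxP : x ∉ boundary P) : 0 ∈ interior ((fun u : vectorSpan ℝ P => x + (u : E)) ⁻¹' P) := by
  set Q := (fun u : vectorSpan ℝ P => x + (u : E)) ⁻¹' P
  have hQ : Convex ℝ Q :=
    (hP.translate_preimage_right x).is_linear_preimage (vectorSpan ℝ P).subtype.isLinear
  have hint : (interior Q).Nonempty :=
    hQ.interior_nonempty_iff_affineSpan_eq_top.2 (affineSpan_preimage_add_vectorSpan_eq_top hx)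
  by_contra hzero
  obtain ⟨f, hf, hfQ⟩ := geometric_hahn_banach_of_nonempty_interior_point hQ hzero hint
  obtain ⟨L, hL⟩ := f.toLinearMap.exists_extend
  replace hL (u : vectorSpan ℝ P) : L u = f u := LinearMap.congr_fun hL u
  have hLP : ∀ y ∈ P, L y ≤ L x := by
    intro y hy
    have hle := hfQ ⟨y - x, vsub_mem_vectorSpan ℝ hy hx⟩ (by simpa [Q] using hy)
    rwa [← hL, map_zero, map_sub, sub_nonpos] at hle
  refine hxP ⟨hx, {y ∈ P | L.toContinuousLinearMap y = L x},
    ⟨isFace_iff_exists_dual.2 ⟨⟨x, hx, rfl⟩, _, _, hLP, rfl⟩, fun hface => hf ?_⟩, hx, rfl⟩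
  ext u
  rw [← hL]
  exact vectorSpan_le_ker_of_forall_eq (f := L) (fun y hy => (hface.ge hy).2) u.2

theorem exists_prolongation (hP : Convex ℝ P) {x y : E} (hx : x ∈ P) (hxP : x ∉ boundary P)
    (hy : y ∈ P) : ∃ ε > (0 : ℝ), x + ε • (x - y) ∈ P := by
  have hxy : x - y ∈ vectorSpan ℝ P := vsub_mem_vectorSpan ℝ hx hy
  have hcont : Filter.Tendsto (fun ε : ℝ => ε • (⟨x - y, hxy⟩ : vectorSpan ℝ P)) (nhds 0)
      (nhds 0) := by
    have : Continuous fun ε : ℝ => ε • (⟨x - y, hxy⟩ : vectorSpan ℝ P) := by fun_prop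
    simpa using this.tendsto 0
  have hev : ∀ᶠ ε : ℝ in nhdsWithin 0 (Set.Ioi 0), x + ε • (x - y) ∈ P :=
    nhdsWithin_le_nhds <| hcont.eventually <|
      mem_interior_iff_mem_nhds.1 (zero_mem_interior_preimage_add hP hx hxP)
  obtain ⟨ε, hmem, hε⟩ := (hev.and self_mem_nhdsWithin).exists
  exact ⟨ε, hε, hmem⟩

end FiniteDimensional

variable {K : Geometry.SimplicialComplex ℝ E} {v : Set E → E}

namespace IsPointedTriangulation

theorem subset_polytope (hK : IsPointedTriangulation P K v) {s : Finset E} (hs : s ∈ K.faces) :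
    (s : Set E) ⊆ P :=
  hK.space_eq ▸ K.subset_space hs

theorem exists_simplex_superset (hK : IsPointedTriangulation P K v) (hP : Convex ℝ P)
    (hF : IsFace P F) {s : Finset E} (hs : s ∈ K.faces) (hsF : (s : Set E) ⊆ F) :
    ∃ r ∈ simplicesIn K F (dim F), s ⊆ r :=
  hK.pure_face F hF s hs (convexHull_min hsF (hF.convex hP))

theorem exists_simplex_mem_convexHull (hK : IsPointedTriangulation P K v) (hP : Convex ℝ P)
    (hF : IsFace P F) {x : E} (hx : x ∈ F) :
    ∃ r ∈ simplicesIn K F (dim F), x ∈ convexHull ℝ (r : Set E) := by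
  classical
  have hxK : x ∈ K.space := hK.space_eq ▸ hF.subset hx
  obtain ⟨s, hs, hxs⟩ := Geometry.SimplicialComplex.mem_space_iff.1 hxK
  have hxsF := convexHull_inter_subset_of_isExtreme hF.isExtreme
    (convexHull_min (hK.subset_polytope hs) hP) ⟨hxs, hx⟩
  have hcoe : (s ∩ F : Set E) = (s.filter (· ∈ F) : Finset E) := by simp [Set.inter_def]
  rw [hcoe] at hxsF
  have hne : (s.filter (· ∈ F)).Nonempty :=
    Finset.coe_nonempty.1 (convexHull_nonempty_iff.1 ⟨x, hxsF⟩)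
  obtain ⟨r, hr, hsr⟩ := hK.exists_simplex_superset hP hF
    (K.down_closed hs (Finset.filter_subset _ s) hne) fun u hu => (Finset.mem_filter.1 hu).2
  exact ⟨r, hr, convexHull_mono (Finset.coe_subset.2 hsr) hxsF⟩

theorem apex_mem_face (hK : IsPointedTriangulation P K v) (hF : IsFace P F) : v F ∈ F :=
  IsFace.subset (hK.apex_vert F hF) rfl

theorem apex_mem_simplex (hK : IsPointedTriangulation P K v) (hF : IsFace P F) {s : Finset E}
    (hs : s ∈ simplicesIn K F (dim F)) : v F ∈ s := by
  have hmem := convexHull_inter_subset_of_isExtreme (hK.apex_vert F hF).isExtreme hs.2.1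
    ⟨hK.apex_mem F hF s hs, rfl⟩
  obtain ⟨u, hus, rfl⟩ := convexHull_nonempty_iff.1 ⟨_, hmem⟩
  exact hus

/- Prolong the segment from the apex to a relatively interior point `x` of `s` beyond `x`. It ends
in a top-dimensional simplex `r` of `F`, which contains the apex; so `x` has a positive coordinate
at the apex with respect to `r`, hence with respect to `s`. -/
theorem apex_mem_of_isCarrier [FiniteDimensional ℝ E] (hK : IsPointedTriangulation P K v)
    (hP : Convex ℝ P) (hF : IsFace P F) {s : Finset E} (hs : s ∈ K.faces)
    (hsF : IsCarrier F (s : Set E)) : v F ∈ s := by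
  classical
  obtain ⟨x, w, hw, hpos⟩ := exists_isBarycentric_ne_zero (𝕜 := ℝ) (K.nonempty_of_mem_faces hs)
  have hFc : Convex ℝ F := hF.convex hP
  have hxF : x ∈ F := convexHull_min hsF.1 hFc hw.mem_convexHull
  have hxint : x ∉ boundary F := fun ⟨_, G, hG, hxG⟩ => hsF.2 G hG fun u hu =>
    hG.1.mem_of_isBarycentric hsF.1 hw hxG (hpos u hu)
  obtain ⟨ε, hε, hy⟩ := exists_prolongation hFc hxF hxint (hK.apex_mem_face hF)
  obtain ⟨r, hr, hyr⟩ := hK.exists_simplex_mem_convexHull hP hF hy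
  obtain ⟨z, hz⟩ := mem_convexHull_iff_exists_isBarycentric.1 hyr
  have hcombo := hz.combo (.single (hK.apex_mem_simplex hF hr)) (a := (1 + ε)⁻¹)
    (b := (1 + ε)⁻¹ * ε) (by positivity) (by positivity) (by field_simp)
  have hx : (1 + ε)⁻¹ • (x + ε • (x - v F)) + ((1 + ε)⁻¹ * ε) • v F = x := by
    rw [mul_smul, ← smul_add, inv_smul_eq_iff₀ (by positivity)]
    module
  rw [hx] at hcombo
  refine hw.mem_of_ne_zero (ne_of_gt ?_)
  rw [hw.unique_of_mem_faces hs hr.1 hcombo]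
  have hz₀ := hz.nonneg (v F)
  simp only [Pi.add_apply, Pi.smul_apply, Pi.single_eq_same, smul_eq_mul]
  positivity

end IsPointedTriangulation

/-- The multisets of size `m` of points of `A` that are supported on a simplex of `K`. Evaluating a
multiset at its sum turns those on a simplex `α` into the points of `S_α(m + 1)`. -/
def multisetsIn (K : Geometry.SimplicialComplex ℝ E) (A : Set E) (m : ℕ) : Set (Multiset E) :=
  {x | x.card = m ∧ (∃ s ∈ K.faces, ∀ u ∈ x, u ∈ s) ∧ ∀ u ∈ x, u ∈ A}

/-- The multisets in `multisetsIn K F m` that lie in no proper face of `F`. They are counted by the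
interior polytope number of `F`. -/
def innerMultisetsIn (K : Geometry.SimplicialComplex ℝ E) (F : Set E) (m : ℕ) :
    Set (Multiset E) :=
  {x ∈ multisetsIn K F m | IsCarrier F {u | u ∈ x}}

section Multisets

theorem finite_setOf_card_eq_of_forall_mem {α : Type*} (s : Finset α) (m : ℕ) :
    {x : Multiset α | x.card = m ∧ ∀ u ∈ x, u ∈ s}.Finite := by
  classical
  refine ((s.sym m).finite_toSet.image Subtype.val).subset fun x ⟨hx, hxs⟩ => ?_
  exact ⟨⟨x, hx⟩, Finset.mem_sym_iff.2 hxs, rfl⟩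

theorem finite_multisetsIn (hK : K.faces.Finite) (A : Set E) (m : ℕ) :
    (multisetsIn K A m).Finite := by
  refine (hK.biUnion fun s _ => finite_setOf_card_eq_of_forall_mem s m).subset ?_
  rintro x ⟨hx, ⟨s, hs, hxs⟩, -⟩
  exact Set.mem_biUnion hs ⟨hx, hxs⟩

theorem exists_mem_faces_coe_eq {x : Multiset E} (hx : x ≠ 0)
    (hxK : ∃ s ∈ K.faces, ∀ u ∈ x, u ∈ s) : ∃ s ∈ K.faces, (s : Set E) = {u | u ∈ x} := by
  classical
  obtain ⟨s, hs, hxs⟩ := hxK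
  refine ⟨x.toFinset, K.down_closed hs (fun u hu => hxs u (Multiset.mem_toFinset.1 hu)) ?_, ?_⟩
  · exact Multiset.toFinset_nonempty.2 hx
  · ext u
    simp

theorem innerMultisetsIn_subset (K : Geometry.SimplicialComplex ℝ E) (F : Set E) (m : ℕ) :
    innerMultisetsIn K F m ⊆ multisetsIn K F m :=
  Set.sep_subset _ _

namespace IsPointedTriangulation

theorem mem_multisetsIn_iff (hK : IsPointedTriangulation P K v) (hP : Convex ℝ P)
    (hF : IsFace P F) {x : Multiset E} {m : ℕ} :
    x ∈ multisetsIn K F m ↔ x.card = m ∧ ∃ r ∈ simplicesIn K F (dim F), ∀ u ∈ x, u ∈ r := by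
  refine and_congr_right fun _ => ⟨fun ⟨hxK, hxF⟩ => ?_, fun ⟨r, hr, hxr⟩ =>
    ⟨⟨r, hr.1, hxr⟩, fun u hu => hr.2.1 (subset_convexHull ℝ _ (hxr u hu))⟩⟩
  obtain rfl | hx := eq_or_ne x 0
  · obtain ⟨r, hr, -⟩ := hK.exists_simplex_mem_convexHull hP hF (hK.apex_mem_face hF)
    exact ⟨r, hr, by simp⟩
  · obtain ⟨s, hs, hsx⟩ := exists_mem_faces_coe_eq hx hxK
    obtain ⟨r, hr, hsr⟩ := hK.exists_simplex_superset hP hF hs (hsx.trans_subset hxF)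
    exact ⟨r, hr, fun u hu => hsr (hsx.ge hu)⟩

theorem apex_cons_mem_multisetsIn_iff (hK : IsPointedTriangulation P K v) (hP : Convex ℝ P)
    (hF : IsFace P F) {x : Multiset E} {m : ℕ} :
    v F ::ₘ x ∈ multisetsIn K F (m + 1) ↔ x ∈ multisetsIn K F m := by
  rw [hK.mem_multisetsIn_iff hP hF, hK.mem_multisetsIn_iff hP hF, Multiset.card_cons,
    Nat.add_right_cancel_iff]
  refine and_congr_right fun _ => exists_congr fun r => and_congr_right fun hr => ?_
  simp [hK.apex_mem_simplex hF hr]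

theorem apex_mem_of_mem_innerMultisetsIn [FiniteDimensional ℝ E]
    (hK : IsPointedTriangulation P K v) (hP : Convex ℝ P) (hF : IsFace P F) {x : Multiset E}
    {m : ℕ} (hx : x ∈ innerMultisetsIn K F (m + 1)) : v F ∈ x := by
  have hx₀ : x ≠ 0 := by
    rintro rfl
    exact (Nat.succ_ne_zero m) hx.1.1.symm
  obtain ⟨s, hs, hsx⟩ := exists_mem_faces_coe_eq hx₀ hx.1.2.1
  exact hsx.le (hK.apex_mem_of_isCarrier hP hF hs (hsx ▸ hx.2))

end IsPointedTriangulation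

theorem eq_of_mem_innerMultisetsIn (hF : IsFace P F) (hG : IsFace P G) {x : Multiset E} {m : ℕ}
    (hxF : x ∈ innerMultisetsIn K F (m + 1)) (hxG : x ∈ innerMultisetsIn K G (m + 1)) : F = G :=
  IsCarrier.eq (Multiset.card_pos_iff_exists_mem.1 (hxF.1.1 ▸ m.succ_pos)) hF hG hxF.2 hxG.2

theorem exists_mem_innerMultisetsIn (hP : IsPolytope d P) (hF : IsFace P F) {x : Multiset E}
    {m : ℕ} (hx : x ∈ multisetsIn K F m) :
    ∃ G, IsFace P G ∧ G ⊆ F ∧ x ∈ innerMultisetsIn K G m := by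
  obtain ⟨G, hG, hGF, hxG⟩ := hP.exists_isCarrier hF hx.2.2
  exact ⟨G, hG, hGF, ⟨hx.1, hx.2.1, hxG.1⟩, hxG⟩

theorem finsum_ncard_innerMultisetsIn (hP : IsPolytope d P) (hK : K.faces.Finite)
    {p : Set E → Prop} (hp : ∀ G, p G → IsFace P G) (m : ℕ) :
    ∑ᶠ G : {G // p G}, ((innerMultisetsIn K G.1 (m + 1)).ncard : ℤ) =
      (⋃ G : {G // p G}, innerMultisetsIn K G.1 (m + 1)).ncard := by
  have : Finite {G // p G} := hP.finite_setOf_isFace.subset hp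
  rw [Set.ncard_iUnion_of_finite, Nat.cast_finsum]
  · exact fun G => (finite_multisetsIn hK _ _).subset (innerMultisetsIn_subset K _ _)
  · exact fun G H hGH => Set.disjoint_left.2 fun x hxG hxH =>
      hGH (Subtype.ext (eq_of_mem_innerMultisetsIn (hp _ G.2) (hp _ H.2) hxG hxH))

theorem iUnion_innerMultisetsIn_proper (hP : IsPolytope d P) (hF : IsFace P F) (m : ℕ) :
    ⋃ G : {G // IsProperFace F G}, innerMultisetsIn K G.1 m =
      multisetsIn K F m \ innerMultisetsIn K F m := by
  refine Set.Subset.antisymm (Set.iUnion_subset fun G x hx => ?_) fun x ⟨hx, hxF⟩ => ?_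
  · exact ⟨⟨hx.1.1, hx.1.2.1, fun u hu => G.2.1.subset (hx.1.2.2 u hu)⟩,
      fun hxF => hxF.2.2 G.1 G.2 hx.1.2.2⟩
  · obtain ⟨G, hG, hGF, hxG⟩ := exists_mem_innerMultisetsIn hP hF hx
    have hne : G ≠ F := by
      rintro rfl
      exact hxF hxG
    exact Set.mem_iUnion.2 ⟨⟨G, hG.mono hF.subset hGF, hne⟩, hxG⟩

theorem not_isProperFace_of_dim_eq_zero [FiniteDimensional ℝ E] (hF : dim F = 0) :
    ¬IsProperFace F G :=
  fun hG => Nat.not_lt_zero _ (hF ▸ hG.dim_lt)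

theorem innerMultisetsIn_of_dim_eq_zero [FiniteDimensional ℝ E] (hF : dim F = 0) (m : ℕ) :
    innerMultisetsIn K F m = multisetsIn K F m :=
  Set.sep_eq_self_iff_mem_true.2 fun _ hx =>
    ⟨hx.2.2, fun _ hG => (not_isProperFace_of_dim_eq_zero hF hG).elim⟩

namespace IsPointedTriangulation

-- The condition `apex_eq` enters here: if `v F` lay in the carrier `G` of `x`, it would equal
-- `v G`, which is a member of `x`.
theorem iUnion_innerMultisetsIn_apex_notMem [FiniteDimensional ℝ E]
    (hK : IsPointedTriangulation P K v) (hP : IsPolytope d P) (hF : IsFace P F) (m : ℕ) :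
    ⋃ G : {G // IsProperFace F G ∧ v F ∉ G}, innerMultisetsIn K G.1 (m + 1) =
      multisetsIn K F (m + 1) \ (v F ::ₘ ·) '' multisetsIn K F m := by
  refine Set.Subset.antisymm (Set.iUnion_subset fun G x hx => ⟨?_, ?_⟩) fun x ⟨hx, hxv⟩ => ?_
  · exact ⟨hx.1.1, hx.1.2.1, fun u hu => G.2.1.1.subset (hx.1.2.2 u hu)⟩
  · rintro ⟨y, -, rfl⟩
    exact G.2.2 (hx.1.2.2 _ (Multiset.mem_cons_self _ _))
  · have hvx : v F ∉ x := fun hmem => by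
      obtain ⟨y, rfl⟩ := Multiset.exists_cons_of_mem hmem
      exact hxv ⟨y, (hK.apex_cons_mem_multisetsIn_iff hP.convex hF).1 hx, rfl⟩
    obtain ⟨G, hG, hGF, hxG⟩ := exists_mem_innerMultisetsIn hP hF hx
    have hvG : v F ∉ G := fun hmem => hvx <| by
      have hvGG := hK.apex_mem_face hG
      rw [hK.apex_eq F G hF hG (Set.pair_subset ⟨hK.apex_mem_face hF, hmem⟩ ⟨hGF hvGG, hvGG⟩)]
      exact hK.apex_mem_of_mem_innerMultisetsIn hP.convex hG hxG
    have hne : G ≠ F := fun h => hvG (h.ge (hK.apex_mem_face hF))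
    exact Set.mem_iUnion.2 ⟨⟨G, ⟨hG.mono hF.subset hGF, hne⟩, hvG⟩, hxG⟩

theorem ncard_multisetsIn_succ [FiniteDimensional ℝ E] (hK : IsPointedTriangulation P K v)
    (hP : IsPolytope d P) (hF : IsFace P F) (m : ℕ) :
    ((multisetsIn K F (m + 1)).ncard : ℤ) = (multisetsIn K F m).ncard +
      ∑ᶠ G : {G // IsProperFace F G ∧ v F ∉ G}, ((innerMultisetsIn K G.1 (m + 1)).ncard : ℤ) := by
  have hsub : (v F ::ₘ ·) '' multisetsIn K F m ⊆ multisetsIn K F (m + 1) :=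
    Set.image_subset_iff.2 fun x hx => (hK.apex_cons_mem_multisetsIn_iff hP.convex hF).2 hx
  have hcons : Function.Injective (v F ::ₘ ·) := fun x y => (Multiset.cons_inj_right _).1
  rw [finsum_ncard_innerMultisetsIn hP hK.finite_faces fun G hG => hF.trans hP hG.1.1,
    hK.iUnion_innerMultisetsIn_apex_notMem hP hF m,
    Set.cast_ncard_sdiff hsub (finite_multisetsIn hK.finite_faces _ _),
    Set.ncard_image_of_injective _ hcons, add_sub_cancel]

theorem ncard_innerMultisetsIn_succ (hK : IsPointedTriangulation P K v) (hP : IsPolytope d P)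
    (hF : IsFace P F) (m : ℕ) :
    ((innerMultisetsIn K F (m + 1)).ncard : ℤ) = (multisetsIn K F (m + 1)).ncard -
      ∑ᶠ G : {G // IsProperFace F G}, ((innerMultisetsIn K G.1 (m + 1)).ncard : ℤ) := by
  rw [finsum_ncard_innerMultisetsIn hP hK.finite_faces fun G hG => hF.trans hP hG.1,
    iUnion_innerMultisetsIn_proper hP hF (m + 1), Set.cast_ncard_sdiff
      (innerMultisetsIn_subset K F _) (finite_multisetsIn hK.finite_faces _ _), sub_sub_cancel]

theorem multisetsIn_zero (hK : IsPointedTriangulation P K v) (hP : Convex ℝ P)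
    (hF : IsFace P F) : multisetsIn K F 0 = {0} := by
  refine Set.Subset.antisymm (fun x hx => Multiset.card_eq_zero.1 hx.1) ?_
  obtain ⟨r, hr, -⟩ := hK.exists_simplex_mem_convexHull hP hF (hK.apex_mem_face hF)
  rintro _ rfl
  exact ⟨rfl, ⟨r, hr.1, by simp⟩, by simp⟩

theorem innerMultisetsIn_zero (hK : IsPointedTriangulation P K v) (hF : IsFace P F)
    (hdim : dim F ≠ 0) : innerMultisetsIn K F 0 = ∅ := by
  have hvF : IsProperFace F {v F} := by
    refine ⟨hK.apex_vert F hF, fun h => hdim ?_⟩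
    rw [← h, dim, vectorSpan_singleton, finrank_bot]
  refine Set.eq_empty_of_forall_notMem fun x hx => hx.2.2 _ hvF fun u hu => ?_
  rw [Set.mem_ofPred_eq, Multiset.card_eq_zero.1 hx.1.1] at hu
  exact (Multiset.notMem_zero u hu).elim

theorem multisetsIn_of_dim_eq_zero (hK : IsPointedTriangulation P K v) (hP : Convex ℝ P)
    (hF : IsFace P F) (hdim : dim F = 0) (m : ℕ) :
    multisetsIn K F m = {Multiset.replicate m (v F)} := by
  have hr_eq : ∀ r ∈ simplicesIn K F (dim F), r = {v F} := fun r hr =>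
    Finset.eq_singleton_iff_unique_mem.2 ⟨hK.apex_mem_simplex hF hr, fun u hu =>
      Finset.card_le_one.1 (hr.2.2.trans (by rw [hdim])).le u hu _ (hK.apex_mem_simplex hF hr)⟩
  obtain ⟨r, hr, -⟩ := hK.exists_simplex_mem_convexHull hP hF (hK.apex_mem_face hF)
  ext x
  rw [hK.mem_multisetsIn_iff hP hF, Set.mem_singleton_iff, Multiset.eq_replicate]
  refine and_congr_right fun _ => ⟨fun ⟨q, hq, hxq⟩ u hu => ?_, fun hx => ⟨r, hr, fun u hu => ?_⟩⟩
  · simpa [hr_eq q hq] using hxq u hu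
  · simpa [hr_eq r hr] using hx u hu

theorem polytopeNumbers_succ_eq_ncard [FiniteDimensional ℝ E] (hK : IsPointedTriangulation P K v)
    (hP : IsPolytope d P) (hF : IsFace P F) (m : ℕ) :
    polytopeNumber v F (m + 1) = (multisetsIn K F m).ncard ∧
      interiorPolytopeNumber v F (m + 1) = (innerMultisetsIn K F m).ncard := by
  induction h : dim F using Nat.strong_induction_on generalizing F m with
  | _ k ih =>
    by_cases hdim : dim F = 0
    · rw [innerMultisetsIn_of_dim_eq_zero hdim, hK.multisetsIn_of_dim_eq_zero hP.convex hF hdim]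
      cases m <;> simp [polytopeNumber, interiorPolytopeNumber, hdim]
    have hproper : ∀ G, IsProperFace F G → ∀ m,
        interiorPolytopeNumber v G (m + 1) = (innerMultisetsIn K G m).ncard :=
      fun G hG m => (ih _ (h ▸ hG.dim_lt) (hF.trans hP hG.1) m rfl).2
    have hnum : ∀ m, polytopeNumber v F (m + 1) = (multisetsIn K F m).ncard := by
      intro m
      induction m with
      | zero => simp [polytopeNumber, hK.multisetsIn_zero hP.convex hF]
      | succ m ihm =>
        rw [polytopeNumber, if_neg hdim, ihm, hK.ncard_multisetsIn_succ hP hF]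
        exact congrArg _ (finsum_congr fun G => hproper G.1 G.2.1 _)
    refine ⟨hnum m, ?_⟩
    cases m with
    | zero => simp [interiorPolytopeNumber, hdim, hK.innerMultisetsIn_zero hF hdim]
    | succ m =>
      rw [interiorPolytopeNumber, if_neg hdim, hnum, hK.ncard_innerMultisetsIn_succ hP hF]
      exact congrArg _ (finsum_congr fun G => hproper G.1 G.2 _)

end IsPointedTriangulation

end Multisets

section PointSets

theorem pointSet_zero (s : Finset E) : pointSet s 0 = ∅ := by
  refine Set.image_eq_empty.2 (Set.eq_empty_of_forall_notMem fun x hx => ?_)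
  have hsum : ((∑ u, x u : ℕ) : ℤ) = ((0 : ℕ) : ℤ) - 1 := hx
  omega

theorem pointSet_succ (s : Finset E) (m : ℕ) :
    pointSet s (m + 1) = Multiset.sum '' {x : Multiset E | x.card = m ∧ ∀ u ∈ x, u ∈ s} := by
  classical
  refine Set.Subset.antisymm ?_ ?_
  · rintro _ ⟨f, hf, rfl⟩
    have hsum : ((∑ u, f u : ℕ) : ℤ) = ((m + 1 : ℕ) : ℤ) - 1 := hf
    refine ⟨∑ u, f u • ({(u : E)} : Multiset E), ⟨?_, fun u hu => ?_⟩, ?_⟩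
    · simpa using show ∑ u, f u = m by omega
    · obtain ⟨i, -, hi⟩ := Multiset.mem_sum.1 hu
      rw [Multiset.mem_singleton.1 (Multiset.mem_of_mem_nsmul hi)]
      exact i.2
    · rw [← Multiset.coe_sumAddMonoidHom, map_sum]
      simp [Nat.cast_smul_eq_nsmul, Multiset.sum_nsmul]
  · rintro _ ⟨x, ⟨hxm, hxs⟩, rfl⟩
    refine ⟨fun u => x.count (u : E), ?_, ?_⟩
    · have hsum : ∑ u : s, x.count (u : E) = m := by
        rw [Finset.sum_coe_sort s fun u => x.count u, Multiset.sum_count_eq_card hxs, hxm]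
      simp only [standardPoints, Set.mem_ofPred_eq, hsum, Nat.cast_succ, add_sub_cancel_right]
    · simp only [Nat.cast_smul_eq_nsmul]
      rw [Finset.sum_coe_sort s fun u => x.count u • u]
      exact (Finset.sum_multiset_count_of_subset x s fun u hu =>
        hxs u (Multiset.mem_toFinset.1 hu)).symm

theorem unionPoints_zero (d : ℕ) (K : Geometry.SimplicialComplex ℝ E) : unionPoints d K 0 = ∅ := by
  simp [unionPoints, pointSet_zero]

theorem injOn_sum_multisetsIn (K : Geometry.SimplicialComplex ℝ E) (A : Set E) (m : ℕ) :
    Set.InjOn Multiset.sum (multisetsIn K A m) := by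
  classical
  rintro x ⟨rfl, ⟨s, hs, hxs⟩, -⟩ y ⟨hyx, ⟨t, ht, hyt⟩, -⟩ hxy
  obtain rfl | hx := eq_or_ne x 0
  · exact (Multiset.card_eq_zero.1 hyx).symm
  have hcard : (x.card : ℝ)⁻¹ ≠ 0 := by simpa using hx
  have hy : y ≠ 0 := by
    rwa [← Multiset.card_pos, hyx, Multiset.card_pos]
  have hbary := isBarycentric_count (𝕜 := ℝ) hy hyt
  rw [hyx, ← hxy] at hbary
  have hweights := (isBarycentric_count hx hxs).unique_of_mem_faces hs ht hbary
  exact Multiset.ext.2 fun u => Nat.cast_injective (mul_left_cancel₀ hcard (congrFun hweights u))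

namespace IsPointedTriangulation

theorem unionPoints_succ (hK : IsPointedTriangulation P K v) (hP : IsPolytope d P) (m : ℕ) :
    unionPoints d K (m + 1) = Multiset.sum '' multisetsIn K P m := by
  obtain rfl := hP.2
  have hmem := fun x : Multiset E =>
    hK.mem_multisetsIn_iff hP.convex (.refl hP.nonempty) (x := x) (m := m)
  ext p
  simp only [unionPoints, pointSet_succ, Set.mem_iUnion, exists_prop]
  refine ⟨?_, ?_⟩
  · rintro ⟨s, ⟨hs, hcard⟩, x, ⟨hx, hxs⟩, rfl⟩
    have hsP := convexHull_min (hK.subset_polytope hs) hP.convex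
    exact ⟨x, (hmem x).2 ⟨hx, s, ⟨hs, hsP, hcard⟩, hxs⟩, rfl⟩
  · rintro ⟨x, hx, rfl⟩
    obtain ⟨hx, s, ⟨hs, -, hcard⟩, hxs⟩ := (hmem x).1 hx
    exact ⟨s, ⟨hs, hcard⟩, x, ⟨hx, hxs⟩, rfl⟩

theorem boundaryPoints_succ [FiniteDimensional ℝ E] (hK : IsPointedTriangulation P K v)
    (hP : IsPolytope d P) (m : ℕ) :
    boundaryPoints d P K (m + 1) =
      Multiset.sum '' (multisetsIn K P m \ innerMultisetsIn K P m) := by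
  have hboundary : ∀ s ∈ K.faces, convexHull ℝ (s : Set E) ⊆ boundary P ↔
      ∃ G, IsProperFace P G ∧ (s : Set E) ⊆ G := fun s hs =>
    convexHull_subset_boundary_iff hP.convex (K.nonempty_of_mem_faces hs) (hK.subset_polytope hs)
  ext p
  simp only [boundaryPoints, pointSet_succ, Set.mem_iUnion, exists_prop]
  refine ⟨?_, ?_⟩
  · rintro ⟨s, ⟨hs, -, hsP⟩, x, ⟨hx, hxs⟩, rfl⟩
    obtain ⟨G, hG, hsG⟩ := (hboundary s hs).1 hsP
    exact ⟨x, ⟨⟨hx, ⟨s, hs, hxs⟩, fun u hu => hK.subset_polytope hs (hxs u hu)⟩,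
      fun hxP => hxP.2.2 G hG fun u hu => hsG (hxs u hu)⟩, rfl⟩
  · rw [← iUnion_innerMultisetsIn_proper hP (.refl hP.nonempty)]
    rintro ⟨x, hx, rfl⟩
    obtain ⟨⟨F, hF⟩, ⟨hx, hxK, hxF⟩, -⟩ := Set.mem_iUnion.1 hx
    obtain ⟨G, hG, hFG, hdim⟩ := hP.exists_facet hF
    obtain ⟨-, r, hr, hxr⟩ := (hK.mem_multisetsIn_iff hP.convex hG.1).1
      ⟨hx, hxK, fun u hu => hFG (hxF u hu)⟩
    have hrG := (subset_convexHull ℝ _).trans hr.2.1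
    exact ⟨r, ⟨hr.1, hr.2.2.trans (hdim.trans hP.2), (hboundary r hr.1).2 ⟨G, hG, hrG⟩⟩, x,
      ⟨hx, hxr⟩, rfl⟩

end IsPointedTriangulation

end PointSets

end PolytopeNumbers
theorem mainTheorem4 {E : Type*} [NormedAddCommGroup E] [NormedSpace ℝ E] [FiniteDimensional ℝ E]
    (d : ℕ) (P : Set E) (hP : PolytopeNumbers.IsPolytope d P)
    (K : Geometry.SimplicialComplex ℝ E) (v : Set E → E)
    (hK : PolytopeNumbers.IsPointedTriangulation P K v) (n : ℕ) :
    (PolytopeNumbers.unionPoints d K n).Finite ∧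
    PolytopeNumbers.polytopeNumber v P n = ((PolytopeNumbers.unionPoints d K n).ncard : ℤ) ∧
    PolytopeNumbers.interiorPolytopeNumber v P n =
      ((PolytopeNumbers.unionPoints d K n \
        PolytopeNumbers.boundaryPoints d P K n).ncard : ℤ) := by
  open PolytopeNumbers in
  cases n with
  | zero => simp [unionPoints_zero, polytopeNumber, interiorPolytopeNumber]
  | succ m =>
    have hinj := injOn_sum_multisetsIn K P m
    have hinner := innerMultisetsIn_subset K P m
    obtain ⟨hnum, hint⟩ := hK.polytopeNumbers_succ_eq_ncard hP (.refl hP.nonempty) m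
    rw [hK.unionPoints_succ hP, hK.boundaryPoints_succ hP,
      ← hinj.image_sdiff_subset Set.sdiff_subset, Set.sdiff_sdiff_cancel_left hinner,
      hinj.ncard_image, (hinj.mono hinner).ncard_image]
    exact ⟨(finite_multisetsIn hK.finite_faces P m).image _, hnum, hint⟩
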